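/- For $x\in[0,1)$ let $x=[a_1(x),a_2(x),a_3(x),\dots]=\cfrac{1}{a_1(x)+\cfrac{1}{a_2(x)+\ddots}}$ be its regular continued fraction expansion, where the partial quotients $a_n(x)$ are positive integers (finitely many of them if $x$ is rational, infinitely many if $x$ is irrational). Let $$\tau(x):=\inf\Big\{s\ge 0:\ \sum_{n\ge 1}a_n(x)^{-s}<\infty\Big\}\in[0,\infty]$$ be the convergence exponent of the sequence of partial quotients of $x$, where $\inf\emptyset=\infty$ and where for rational $x$ the sum runs over the finitely many partial quotients of $x$ (so that $\tau(x)=0$). Then, for every $\alpha\in[0,\infty]$, $$\dim_{\rm H}\big\{x\in[0,1):\ \tau(x)=\alpha\big\}=\begin{cases}1/2, & 0\le\alpha<\infty,\\ 1, & \alpha=\infty,\end{cases}$$ where $\dim_{\rm H}$ denotes the Hausdorff dimension. -/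

import Mathlib

open scoped NNReal ENNReal

/-- The convergence exponent `inf {s ≥ 0 : ∑ₙ bₙ ^ (-s) < ∞}` of a finite or infinite sequence of
positive numbers; it is `∞` if there is no such `s`. The sum runs over the terms that the sequence
has, so that a finite sequence has convergence exponent `0`. -/
noncomputable def convergenceExponent (b : Stream'.Seq ℝ) : ℝ≥0∞ :=
  ⨅ (s : ℝ≥0) (_ : Summable fun n : ℕ => (b.get? n).elim (0 : ℝ) fun a => a ^ (-(s : ℝ))),
    (s : ℝ≥0∞)

/-- The convergence exponent `τ(x)` of the partial quotients `a₁(x), a₂(x), …` of the regular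
continued fraction expansion `x = [a₁(x), a₂(x), …]` of `x ∈ [0, 1)`. -/
noncomputable def tau (x : ℝ) : ℝ≥0∞ :=
  convergenceExponent (GenContFract.of x).partDens

/-!
A finite convergence exponent forces the partial quotients to tend to infinity, so that, unless
`x` is rational, all but finitely many partial quotients are at least `M`, for every `M`. The
numbers all of whose partial quotients are at least `M` are covered by the cylinders of order `n`,
which are the images of `[0, 1)` under compositions of `n` inverse branches `u ↦ 1 / (a + u)`,
`a ≥ M`, of the Gauss map. Since such a branch contracts by the factor `a ^ (-2)`, the `s`-th powers
of the diameters have sum at most `(∑_{a ≥ M} a ^ (-2 s)) ^ n`, which is at most `1` if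
`s > 1 / 2` and `M` is large (`exists_cover_eventuallyLargeQuotients`). Finitely many exceptional partial
quotients do not matter, as the dimension is countably stable. Hence the set `{τ < ∞}` has
dimension at most `1 / 2` (`dimH_tau_lt_top_le`). Its complement `{τ = ∞}` in `[0, 1)` must then
have dimension `1`.

For the lower bound at a finite `α`, take a sequence `s n ≥ 2` with convergence exponent `α` that
tends to infinity, but at most exponentially. All continued fractions with partial quotients in
`[s n, 2 * s n)` have `τ = α`. They are parametrized by `y ∈ [0, 1)`: add to `s n` the digits of
`y` as a Cantor series with bases `s` (`cfOfCantor`). If two numbers `y`, `z` first differ in the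
`n`-th digit, then `|y - z| ≤ P⁻¹` with `P = s 0 * ⋯ * s (n - 1)`, while the continued fractions
differ at least by a constant times `4 ^ (-n) * (P * s n) ^ (-2)`. The growth conditions make this
at least a constant times `P ^ (-1 / r)` for each `r < 1 / 2`, so that the inverse of the
parametrization is Hölder continuous with exponent `r`
(`exists_abs_sub_le_mul_abs_cfOfCantor_sub_rpow`). As it maps onto `[0, 1)`, the set of continued
fractions has dimension at least `r`.
-/

open Set Filter Metric MeasureTheory Topology

/-! ### The Gauss map and partial quotients -/

/-- The Gauss map `x ↦ {1 / x}`. It fixes `0`, so that an orbit that reaches `0`, which is the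
orbit of a rational number, stays there. -/
noncomputable def gaussMap (x : ℝ) : ℝ := Int.fract x⁻¹

lemma gaussMap_zero : gaussMap 0 = 0 := by simp [gaussMap]

lemma gaussMap_nonneg (x : ℝ) : 0 ≤ gaussMap x := Int.fract_nonneg _

lemma gaussMap_lt_one (x : ℝ) : gaussMap x < 1 := Int.fract_lt_one _

lemma partDens_get?_of_gaussMap_ne_zero (n : ℕ) (v : ℝ)
    (h : ∀ k, gaussMap^[k] (Int.fract v) ≠ 0) :
    (GenContFract.of v).partDens.get? n = some (⌊(gaussMap^[n] (Int.fract v))⁻¹⌋ : ℝ) := by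
  induction n generalizing v with
  | zero =>
    have := GenContFract.of_s_head (h 0)
    exact GenContFract.partDen_eq_s_b this
  | succ n ih =>
    have h1 : (GenContFract.of v).partDens.get? (n + 1)
        = (GenContFract.of (Int.fract v)⁻¹).partDens.get? n := by
      simp only [GenContFract.partDens, Stream'.Seq.map_get?, GenContFract.of_s_succ]
    rw [h1, ih _ fun k => h (k + 1), Function.iterate_succ_apply]
    rfl

lemma irrational_gaussMap_iterate {x : ℝ} (hx : Irrational x) (n : ℕ) :
    Irrational (gaussMap^[n] x) := by
  induction n with
  | zero => exact hx
  | succ n ih =>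
    rw [Function.iterate_succ_apply', gaussMap, Int.fract]
    exact ih.inv.sub_intCast _

/-! ### The inverse branches of the Gauss map -/

lemma abs_inv_add_sub_inv_add {a b u v : ℝ} (ha : 0 < a + u) (hb : 0 < b + v) :
    |(a + u)⁻¹ - (b + v)⁻¹| = |(a + u) - (b + v)| / ((a + u) * (b + v)) := by
  rw [inv_sub_inv ha.ne' hb.ne', abs_div, abs_of_pos (mul_pos ha hb), abs_sub_comm]

lemma lipschitzOnWith_inv_add {a : ℝ≥0} (ha : 0 < a) :
    LipschitzOnWith (a ^ 2)⁻¹ (fun u : ℝ => ((a : ℝ) + u)⁻¹) (Ici 0) := by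
  refine LipschitzOnWith.of_dist_le_mul fun u hu v hv => ?_
  have ha' : (0 : ℝ) < a := ha
  have hu' : (0 : ℝ) ≤ u := hu
  have hv' : (0 : ℝ) ≤ v := hv
  rw [Real.dist_eq, Real.dist_eq, abs_inv_add_sub_inv_add (by positivity) (by positivity),
    add_sub_add_left_eq_sub, div_eq_inv_mul]
  push_cast
  gcongr
  nlinarith

lemma eq_inv_floor_add_gaussMap (x : ℝ) : x = (((⌊x⁻¹⌋ : ℤ) : ℝ) + gaussMap x)⁻¹ := by
  rw [gaussMap, Int.floor_add_fract, inv_inv]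

/-! ### Numbers with large partial quotients -/

/-- The numbers of `[0, 1)` whose partial quotients are all at least `M` from the index `N` on
(indices start at `0`). If `M` is positive, then these numbers are irrational, as `⌊0⁻¹⌋ = 0`. -/
def eventuallyLargeQuotients (M N : ℕ) : Set ℝ :=
  {x | x ∈ Ico (0 : ℝ) 1 ∧ ∀ n ≥ N, (M : ℤ) ≤ ⌊(gaussMap^[n] x)⁻¹⌋}

lemma gaussMap_mem_eventuallyLargeQuotients {M N : ℕ} {x : ℝ}
    (hx : x ∈ eventuallyLargeQuotients M (N + 1)) :
    gaussMap x ∈ eventuallyLargeQuotients M N :=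
  ⟨⟨gaussMap_nonneg x, gaussMap_lt_one x⟩, fun n hn => hx.2 (n + 1) (by omega)⟩

lemma eventuallyLargeQuotients_mono {M N N' : ℕ} (h : N ≤ N') :
    eventuallyLargeQuotients M N ⊆ eventuallyLargeQuotients M N' :=
  fun _ hx => ⟨hx.1, fun n hn => hx.2 n (h.trans hn)⟩

/-- The sets with all partial quotients at least `M` have efficient covers by cylinders of any
order: passing to the next order multiplies the sum of the `s`-th powers of the diameters by at most
`∑_{a ≥ M} a ^ (-2 s)`, because the branch `u ↦ 1 / (a + u)` contracts by the factor `a ^ (-2)`. -/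
lemma exists_cover_eventuallyLargeQuotients {s : ℝ} (hs : 0 < s) {M : ℕ} (hM : 2 ≤ M)
    (hsum : ∑' k : ℕ, ((((((k + M : ℕ) : ℝ≥0) ^ 2)⁻¹ : ℝ≥0) : ℝ≥0∞) ^ s) ≤ 1) (n : ℕ) :
    ∃ t : ℕ → Set ℝ, eventuallyLargeQuotients M 0 ⊆ ⋃ i, t i ∧
      (∀ i, ediam (t i) ≤ (1 / 4 : ℝ≥0∞) ^ n) ∧ ∑' i, ediam (t i) ^ s ≤ 1 := by
  induction n with
  | zero =>
    refine ⟨fun i => if i = 0 then Ico 0 1 else ∅, fun x hx => ?_, fun i => ?_, ?_⟩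
    · exact mem_iUnion.2 ⟨0, by simpa using hx.1⟩
    · by_cases hi : i = 0 <;> simp [hi]
    · rw [tsum_eq_single 0 fun i hi => by simp [hi, hs]]
      simp
  | succ n ih =>
    obtain ⟨t, hcov, hdiam, htsum⟩ := ih
    have key : ∀ k i, ediam ((fun u : ℝ => (((k + M : ℕ) : ℝ≥0) + u)⁻¹) '' (t i ∩ Ici 0))
        ≤ (((((k + M : ℕ) : ℝ≥0) ^ 2)⁻¹ : ℝ≥0) : ℝ≥0∞) * ediam (t i) := by
      intro k i
      have hpos : (0 : ℝ≥0) < ((k + M : ℕ) : ℝ≥0) := by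
        have : 0 < k + M := by omega
        exact_mod_cast this
      refine ediam_image_le_iff.2 fun u hu v hv => ?_
      refine ((lipschitzOnWith_inv_add hpos) hu.2 hv.2).trans ?_
      gcongr
      exact edist_le_ediam_of_mem hu.1 hv.1
    refine ⟨fun j => (fun u : ℝ => ((((Nat.unpair j).1 + M : ℕ) : ℝ≥0) + u)⁻¹) ''
      (t (Nat.unpair j).2 ∩ Ici 0), fun x hx => ?_, fun j => ?_, ?_⟩
    · have hg := gaussMap_mem_eventuallyLargeQuotients
        (eventuallyLargeQuotients_mono (Nat.zero_le 1) hx)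
      obtain ⟨i, hi⟩ := mem_iUnion.1 (hcov hg)
      have h0 := hx.2 0 le_rfl
      simp only [Function.iterate_zero, id_eq] at h0
      obtain ⟨k, hk⟩ := Int.eq_ofNat_of_zero_le (sub_nonneg.2 h0)
      refine mem_iUnion.2 ⟨Nat.pair k i, gaussMap x, ?_, ?_⟩
      · simpa using ⟨hi, gaussMap_nonneg x⟩
      · have : (⌊x⁻¹⌋ : ℝ) = k + M := by
          have : ⌊x⁻¹⌋ = k + M := by omega
          rw [this]; push_cast; rfl
        conv_rhs => rw [eq_inv_floor_add_gaussMap x, this]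
        simp
    · refine (key _ _).trans ?_
      rw [pow_succ' (1 / 4 : ℝ≥0∞)]
      refine mul_le_mul' ?_ (hdiam _)
      · have h4 : (4 : ℝ≥0) ≤ (((Nat.unpair j).1 + M : ℕ) : ℝ≥0) ^ 2 := by
          have : 4 ≤ ((Nat.unpair j).1 + M) ^ 2 :=
            Nat.pow_le_pow_left (show 2 ≤ _ by omega) 2
          exact_mod_cast this
        have h4' : (((((Nat.unpair j).1 + M : ℕ) : ℝ≥0) ^ 2)⁻¹ : ℝ≥0) ≤ 4⁻¹ :=
          inv_anti₀ (by norm_num) h4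
        calc _ ≤ (((4 : ℝ≥0)⁻¹ : ℝ≥0) : ℝ≥0∞) := by exact_mod_cast h4'
          _ = 1 / 4 := by
            rw [ENNReal.coe_inv (by norm_num)]; simp
    · calc _ ≤ ∑' j : ℕ, ((((((Nat.unpair j).1 + M : ℕ) : ℝ≥0) ^ 2)⁻¹ : ℝ≥0) : ℝ≥0∞) ^ s *
            ediam (t (Nat.unpair j).2) ^ s := by
            refine ENNReal.tsum_le_tsum fun j => ?_
            rw [← ENNReal.mul_rpow_of_nonneg _ _ hs.le]
            exact ENNReal.rpow_le_rpow (key _ _) hs.le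
        _ = ∑' p : ℕ × ℕ, (((((p.1 + M : ℕ) : ℝ≥0) ^ 2)⁻¹ : ℝ≥0) : ℝ≥0∞) ^ s *
            ediam (t p.2) ^ s :=
            Nat.pairEquiv.symm.tsum_eq (fun p : ℕ × ℕ =>
              (((((p.1 + M : ℕ) : ℝ≥0) ^ 2)⁻¹ : ℝ≥0) : ℝ≥0∞) ^ s * ediam (t p.2) ^ s)
        _ = (∑' k : ℕ, (((((k + M : ℕ) : ℝ≥0) ^ 2)⁻¹ : ℝ≥0) : ℝ≥0∞) ^ s) *
            ∑' i, ediam (t i) ^ s := by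
            rw [ENNReal.tsum_prod', ← ENNReal.tsum_mul_right]
            exact tsum_congr fun k => by simp only [ENNReal.tsum_mul_left]
        _ ≤ 1 * 1 := mul_le_mul' hsum htsum
        _ = 1 := one_mul 1

lemma exists_tsum_inv_sq_rpow_le_one {s : ℝ} (hs : 1 / 2 < s) :
    ∃ M : ℕ, 2 ≤ M ∧
      ∑' k : ℕ, ((((((k + M : ℕ) : ℝ≥0) ^ 2)⁻¹ : ℝ≥0) : ℝ≥0∞) ^ s) ≤ 1 := by
  have hsummable : Summable fun n : ℕ => (((((n : ℝ≥0) ^ 2)⁻¹ : ℝ≥0)) ^ s : ℝ≥0) := by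
    have h : Summable fun n : ℕ => ((n : ℝ≥0) ^ (2 * s))⁻¹ :=
      NNReal.summable_rpow_inv.2 (by linarith)
    refine h.congr fun n => ?_
    rw [NNReal.inv_rpow, NNReal.rpow_mul]
    norm_num
  have hne : ∑' n : ℕ, (((((n : ℝ≥0) ^ 2)⁻¹ : ℝ≥0) ^ s : ℝ≥0) : ℝ≥0∞) ≠ ∞ :=
    ENNReal.tsum_coe_ne_top_iff_summable.2 hsummable
  have hev := (ENNReal.tendsto_sum_nat_add _ hne).eventually_le_const
    (show (0 : ℝ≥0∞) < 1 by norm_num)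
  obtain ⟨M, h1, h2⟩ := (hev.and (eventually_ge_atTop 2)).exists
  refine ⟨M, h2, ?_⟩
  simpa only [ENNReal.coe_rpow_of_nonneg _ (show 0 ≤ s by linarith)] using h1

lemma dimH_eventuallyLargeQuotients_zero_le {s : ℝ≥0} (hs : 0 < s) {M : ℕ} (hM : 2 ≤ M)
    (hsum : ∑' k : ℕ, ((((((k + M : ℕ) : ℝ≥0) ^ 2)⁻¹ : ℝ≥0) : ℝ≥0∞) ^ (s : ℝ)) ≤ 1) :
    dimH (eventuallyLargeQuotients M 0) ≤ s := by
  choose t hcov hdiam htsum using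
    exists_cover_eventuallyLargeQuotients (NNReal.coe_pos.2 hs) hM hsum
  have h := Measure.hausdorffMeasure_le_liminf_tsum (s : ℝ) (eventuallyLargeQuotients M 0)
    (l := atTop) (fun n : ℕ => (1 / 4 : ℝ≥0∞) ^ n)
    (ENNReal.tendsto_pow_atTop_nhds_zero_of_lt_one (by
      rw [one_div]; exact ENNReal.inv_lt_one.2 (by norm_num))) t (.of_forall hdiam)
    (.of_forall hcov)
  have h1 : liminf (fun n => ∑' i, ediam (t n i) ^ (s : ℝ)) atTop ≤ 1 :=
    (liminf_le_liminf (.of_forall htsum)).trans (by simp)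
  exact dimH_le_of_hausdorffMeasure_ne_top ((h.trans h1).trans_lt ENNReal.one_lt_top).ne

/-- Dropping conditions on finitely many partial quotients does not increase the dimension: the
Gauss map has countably many inverse branches, and they are Lipschitz. -/
lemma dimH_eventuallyLargeQuotients_le {M : ℕ} (hM : 0 < M) (N : ℕ) :
    dimH (eventuallyLargeQuotients M N) ≤ dimH (eventuallyLargeQuotients M 0) := by
  induction N with
  | zero => exact le_rfl
  | succ N ih =>
    have hsub : eventuallyLargeQuotients M (N + 1) ⊆
        ⋃ k : ℕ, (fun u : ℝ => (((k + 1 : ℕ) : ℝ≥0) + u)⁻¹) '' eventuallyLargeQuotients M N := by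
      intro x hx
      have hx0 : 0 < x := by
        refine hx.1.1.lt_of_ne' fun h0 => ?_
        have h := hx.2 (N + 1) le_rfl
        rw [h0, Function.iterate_fixed gaussMap_zero] at h
        simp at h
        omega
      have h1 : 1 ≤ ⌊x⁻¹⌋ := Int.le_floor.2 (by
        simpa using (one_le_inv₀ hx0).2 hx.1.2.le)
      obtain ⟨k, hk⟩ := Int.eq_ofNat_of_zero_le (sub_nonneg.2 h1)
      refine mem_iUnion.2 ⟨k, gaussMap x, gaussMap_mem_eventuallyLargeQuotients hx, ?_⟩
      have : (⌊x⁻¹⌋ : ℝ) = k + 1 := by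
        have : ⌊x⁻¹⌋ = k + 1 := by omega
        rw [this]; push_cast; rfl
      conv_rhs => rw [eq_inv_floor_add_gaussMap x, this]
      simp
    refine (dimH_mono hsub).trans ?_
    rw [dimH_iUnion]
    refine iSup_le fun k => le_trans ?_ ih
    exact ((lipschitzOnWith_inv_add (by positivity)).mono fun x hx => hx.1.1).dimH_image_le

/-! ### Finite convergence exponent forces dimension at most `1 / 2` -/

lemma exists_summable_of_convergenceExponent_lt_top {b : Stream'.Seq ℝ}
    (h : convergenceExponent b < ∞) :
    ∃ s : ℝ≥0, Summable fun n : ℕ => (b.get? n).elim (0 : ℝ) fun a => a ^ (-(s : ℝ)) := by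
  simp only [convergenceExponent, iInf_lt_iff] at h
  obtain ⟨s, hs, -⟩ := h
  exact ⟨s, hs⟩

lemma exists_mem_eventuallyLargeQuotients {x : ℝ} (hx : x ∈ Ico (0 : ℝ) 1) (hirr : Irrational x)
    (hτ : tau x < ∞) (M : ℕ) : ∃ N, x ∈ eventuallyLargeQuotients M N := by
  obtain ⟨s, hs⟩ := exists_summable_of_convergenceExponent_lt_top hτ
  have hfract : Int.fract x = x := Int.fract_eq_self.2 hx
  have hne : ∀ k, gaussMap^[k] (Int.fract x) ≠ 0 := fun k => by
    rw [hfract]; exact (irrational_gaussMap_iterate hirr k).ne_zero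
  simp only [partDens_get?_of_gaussMap_ne_zero _ x hne, hfract, Option.elim_some] at hs
  have hlim := hs.tendsto_atTop_zero
  -- A partial quotient `a ≤ M + 1` would contribute a term `a ^ (-s) ≥ (M + 1) ^ (-s)`.
  have hev := hlim.eventually_lt_const
    (show (0 : ℝ) < ((M : ℝ) + 1) ^ (-(s : ℝ)) by positivity)
  obtain ⟨N, hN⟩ := eventually_atTop.1 hev
  refine ⟨N, hx, fun n hn => ?_⟩
  by_contra! hlt
  have hpos : 0 < gaussMap^[n] x := by
    refine lt_of_le_of_ne ?_ (hfract ▸ hne n).symm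
    cases n with
    | zero => exact hx.1
    | succ n => rw [Function.iterate_succ_apply']; exact gaussMap_nonneg _
  have hlt1 : gaussMap^[n] x < 1 := by
    cases n with
    | zero => exact hx.2
    | succ n => rw [Function.iterate_succ_apply']; exact gaussMap_lt_one _
  have h1 : 1 ≤ ⌊(gaussMap^[n] x)⁻¹⌋ := Int.le_floor.2 (by
    simpa using (one_le_inv₀ hpos).2 hlt1.le)
  have h1' : (1 : ℝ) ≤ ⌊(gaussMap^[n] x)⁻¹⌋ := by exact_mod_cast h1
  have h2 : (⌊(gaussMap^[n] x)⁻¹⌋ : ℝ) ≤ (M : ℝ) + 1 := by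
    have : ((⌊(gaussMap^[n] x)⁻¹⌋ : ℤ) : ℝ) ≤ ((M : ℤ) : ℝ) := by exact_mod_cast hlt.le
    push_cast at this
    linarith
  exact absurd (hN n hn) (not_lt.2
    (Real.rpow_le_rpow_of_nonpos (by linarith) h2 (by simp)))

lemma dimH_tau_lt_top_le : dimH {x : ℝ | x ∈ Ico (0 : ℝ) 1 ∧ tau x < ∞} ≤ 1 / 2 := by
  have hhalf : (1 / 2 : ℝ≥0∞) = ((1 / 2 : ℝ≥0) : ℝ≥0∞) := by
    rw [ENNReal.coe_div (by norm_num)]; simp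
  rw [hhalf]
  refine ENNReal.le_of_forall_pos_le_add fun ε hε _ => ?_
  have hs : (1 / 2 : ℝ) < ((1 / 2 + ε : ℝ≥0) : ℝ) := by
    push_cast
    have : (0 : ℝ) < ε := hε
    linarith
  obtain ⟨M, hM, hsum⟩ := exists_tsum_inv_sq_rpow_le_one hs
  have hsub : {x : ℝ | x ∈ Ico (0 : ℝ) 1 ∧ tau x < ∞} ⊆
      range ((↑) : ℚ → ℝ) ∪ ⋃ N, eventuallyLargeQuotients M N := by
    intro x hx
    by_cases hirr : Irrational x
    · exact .inr (mem_iUnion.2 (exists_mem_eventuallyLargeQuotients hx.1 hirr hx.2 M))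
    · exact .inl (not_not.1 hirr)
  refine (dimH_mono hsub).trans ?_
  rw [dimH_union, dimH_countable (countable_range _), dimH_iUnion]
  refine max_le bot_le (iSup_le fun N => ?_)
  exact (dimH_eventuallyLargeQuotients_le (by omega) N).trans
    (dimH_eventuallyLargeQuotients_zero_le (by positivity) hM hsum)

lemma dimH_Ico_zero_one : dimH (Ico (0 : ℝ) 1) = 1 := by
  rw [Real.dimH_of_nonempty_interior (by simp)]
  simp

lemma dimH_tau_eq_top : dimH {x : ℝ | x ∈ Ico (0 : ℝ) 1 ∧ tau x = ∞} = 1 := by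
  have hunion : {x : ℝ | x ∈ Ico (0 : ℝ) 1 ∧ tau x < ∞} ∪
      {x : ℝ | x ∈ Ico (0 : ℝ) 1 ∧ tau x = ∞} = Ico 0 1 := by
    ext x
    simp only [mem_union, mem_ofPred_eq, ← and_or_left, and_iff_left_iff_imp]
    exact fun _ => lt_or_eq_of_le le_top
  have h := dimH_Ico_zero_one
  rw [← hunion, dimH_union] at h
  have hlt : (1 / 2 : ℝ≥0∞) < 1 := by
    rw [one_div]
    exact ENNReal.inv_lt_one.2 (by norm_num)
  rcases max_choice (dimH {x : ℝ | x ∈ Ico (0 : ℝ) 1 ∧ tau x < ∞})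
    (dimH {x : ℝ | x ∈ Ico (0 : ℝ) 1 ∧ tau x = ∞}) with h' | h'
  · exact absurd ((h.symm.trans h').le.trans dimH_tau_lt_top_le) (not_le.2 hlt)
  · exact h'.symm.trans h

/-! ### Continued fractions with prescribed partial quotients -/

/-- The `n`-th convergent `[a 0, …, a (n - 1)]` of the continued fraction with partial quotients
`a`. -/
noncomputable def cfConvergent : ℕ → (ℕ → ℕ) → ℝ
  | 0, _ => 0
  | n + 1, a => ((a 0 : ℝ) + cfConvergent n fun k => a (k + 1))⁻¹

/-- The value `[a 0, a 1, …]` of the infinite continued fraction with partial quotients `a`. It is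
meaningful for sequences `a` whose convergents converge; only sequences with terms at least `2` are
used. -/
noncomputable def cfValue (a : ℕ → ℕ) : ℝ := limUnder atTop fun n => cfConvergent n a

lemma cfConvergent_nonneg (n : ℕ) (a : ℕ → ℕ) : 0 ≤ cfConvergent n a := by
  induction n generalizing a with
  | zero => exact le_rfl
  | succ n ih =>
    have := ih fun k => a (k + 1)
    rw [cfConvergent]
    positivity

lemma dist_cfConvergent_succ_le {a : ℕ → ℕ} (ha : ∀ n, 2 ≤ a n) (n : ℕ) :
    dist (cfConvergent n a) (cfConvergent (n + 1) a) ≤ 1 * (1 / 4 : ℝ) ^ n := by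
  induction n generalizing a with
  | zero =>
    have h2 : (2 : ℝ) ≤ a 0 := by exact_mod_cast ha 0
    have : (a 0 : ℝ)⁻¹ ≤ 1 := inv_le_one_of_one_le₀ (by linarith)
    simpa [cfConvergent, Real.dist_eq] using this
  | succ n ih =>
    have h2 : (2 : ℝ) ≤ a 0 := by exact_mod_cast ha 0
    have h := ih fun k => ha (k + 1)
    have hu := cfConvergent_nonneg n fun k => a (k + 1)
    have hv := cfConvergent_nonneg (n + 1) fun k => a (k + 1)
    rw [Real.dist_eq] at h ⊢
    rw [cfConvergent, cfConvergent.eq_2 _ (n + 1),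
      abs_inv_add_sub_inv_add (by linarith) (by linarith), add_sub_add_left_eq_sub,
      div_le_iff₀ (by nlinarith), pow_succ]
    have h4 : 4 ≤ ((a 0 : ℝ) + cfConvergent n fun k => a (k + 1)) *
        ((a 0 : ℝ) + cfConvergent (n + 1) fun k => a (k + 1)) := by nlinarith
    have hp : (0 : ℝ) < (1 / 4) ^ n := by positivity
    nlinarith

lemma tendsto_cfConvergent {a : ℕ → ℕ} (ha : ∀ n, 2 ≤ a n) :
    Tendsto (fun n => cfConvergent n a) atTop (𝓝 (cfValue a)) :=
  (cauchySeq_of_le_geometric _ _ (by norm_num) (dist_cfConvergent_succ_le ha)).tendsto_limUnder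

section cfValue

variable {a b : ℕ → ℕ}

lemma cfValue_nonneg (ha : ∀ n, 2 ≤ a n) : 0 ≤ cfValue a :=
  ge_of_tendsto' (tendsto_cfConvergent ha) fun n => cfConvergent_nonneg n a

lemma cfValue_eq (ha : ∀ n, 2 ≤ a n) :
    cfValue a = ((a 0 : ℝ) + cfValue fun k => a (k + 1))⁻¹ := by
  have h2 : (2 : ℝ) ≤ a 0 := by exact_mod_cast ha 0
  have hu := cfValue_nonneg fun k => ha (k + 1)
  refine tendsto_nhds_unique ((tendsto_cfConvergent ha).comp (tendsto_add_atTop_nat 1)) ?_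
  exact ((tendsto_cfConvergent fun k => ha (k + 1)).const_add _).inv₀ (by linarith)

lemma cfValue_pos (ha : ∀ n, 2 ≤ a n) : 0 < cfValue a := by
  have h2 : (2 : ℝ) ≤ a 0 := by exact_mod_cast ha 0
  have hu := cfValue_nonneg fun k => ha (k + 1)
  rw [cfValue_eq ha]
  positivity

lemma cfValue_le_half (ha : ∀ n, 2 ≤ a n) : cfValue a ≤ 1 / 2 := by
  have h2 : (2 : ℝ) ≤ a 0 := by exact_mod_cast ha 0
  have hu := cfValue_nonneg fun k => ha (k + 1)
  rw [cfValue_eq ha, one_div]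
  exact inv_anti₀ (by norm_num) (by linarith)

lemma floor_inv_cfValue (ha : ∀ n, 2 ≤ a n) : ⌊(cfValue a)⁻¹⌋ = a 0 := by
  have hu := cfValue_nonneg fun k => ha (k + 1)
  have hv := cfValue_le_half fun k => ha (k + 1)
  rw [cfValue_eq ha, inv_inv, Int.floor_eq_iff]
  push_cast
  constructor <;> linarith

lemma gaussMap_cfValue (ha : ∀ n, 2 ≤ a n) :
    gaussMap (cfValue a) = cfValue fun k => a (k + 1) := by
  rw [gaussMap, Int.fract, floor_inv_cfValue ha, cfValue_eq ha, inv_inv]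
  simp

lemma gaussMap_iterate_cfValue (ha : ∀ n, 2 ≤ a n) (n : ℕ) :
    gaussMap^[n] (cfValue a) = cfValue fun k => a (k + n) := by
  induction n with
  | zero => rfl
  | succ n ih =>
    rw [Function.iterate_succ_apply', ih, gaussMap_cfValue fun k => ha (k + n)]
    congr 1
    ext k
    congr 1
    ring

lemma partDens_get?_cfValue (ha : ∀ n, 2 ≤ a n) (n : ℕ) :
    (GenContFract.of (cfValue a)).partDens.get? n = some (a n : ℝ) := by
  have hf : Int.fract (cfValue a) = cfValue a :=
    Int.fract_eq_self.2 ⟨cfValue_nonneg ha, (cfValue_le_half ha).trans_lt (by norm_num)⟩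
  rw [partDens_get?_of_gaussMap_ne_zero, hf, gaussMap_iterate_cfValue ha,
    floor_inv_cfValue fun k => ha (k + n)]
  · simp
  · intro k
    rw [hf, gaussMap_iterate_cfValue ha]
    exact (cfValue_pos fun j => ha (j + k)).ne'

lemma tau_cfValue (ha : ∀ n, 2 ≤ a n) :
    tau (cfValue a) =
      ⨅ (s : ℝ≥0) (_ : Summable fun n : ℕ => (a n : ℝ) ^ (-(s : ℝ))), (s : ℝ≥0∞) := by
  simp only [tau, convergenceExponent, partDens_get?_cfValue ha, Option.elim_some]

lemma cfValue_shift_eq (ha : ∀ n, 2 ≤ a n) (n : ℕ) :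
    cfValue (fun k => a (k + n)) = ((a n : ℝ) + cfValue fun k => a (k + (n + 1)))⁻¹ := by
  rw [cfValue_eq fun k => ha (k + n)]
  simp only [zero_add, add_assoc, add_comm 1 n]

/-- Along `n` common partial quotients the inverse branches shrink distances at most by the factors
`(a i + 1) ^ (-2)`. -/
lemma prod_mul_abs_cfValue_shift_sub_le (ha : ∀ n, 2 ≤ a n) (hb : ∀ n, 2 ≤ b n) (n : ℕ)
    (h : ∀ i < n, a i = b i) :
    |cfValue (fun k => a (k + n)) - cfValue fun k => b (k + n)| ≤
      (∏ i ∈ Finset.range n, ((a i : ℝ) + 1) ^ 2) * |cfValue a - cfValue b| := by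
  induction n with
  | zero => simp
  | succ n ih =>
    have h2 : (2 : ℝ) ≤ a n := by exact_mod_cast ha n
    have hu := cfValue_nonneg fun k => ha (k + (n + 1))
    have hv := cfValue_nonneg fun k => hb (k + (n + 1))
    have hu' := cfValue_le_half fun k => ha (k + (n + 1))
    have hv' := cfValue_le_half fun k => hb (k + (n + 1))
    have h' := ih fun i hi => h i (by omega)
    rw [cfValue_shift_eq ha, cfValue_shift_eq hb, ← h n (by omega),
      abs_inv_add_sub_inv_add (by linarith) (by linarith), add_sub_add_left_eq_sub,
      div_le_iff₀ (by nlinarith)] at h'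
    rw [Finset.prod_range_succ]
    refine h'.trans ?_
    rw [mul_right_comm]
    gcongr
    nlinarith

/-- If the partial quotients first differ at the index `n`, then the numbers have distance at least
`1 / 2 * ∏ i ≤ n, (2 * s i) ^ (-2)`. The gap `1 / 2` comes from the fact that all partial quotients
are at least `2`, so that the tails lie in `[0, 1 / 2]`. -/
lemma one_le_prod_mul_abs_cfValue_sub {s : ℕ → ℕ} (ha : ∀ n, 2 ≤ a n) (hb : ∀ n, 2 ≤ b n)
    (has : ∀ n, a n < 2 * s n) (hbs : ∀ n, b n < 2 * s n) {n : ℕ} (h : ∀ i < n, a i = b i)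
    (hn : a n ≠ b n) :
    1 ≤ 2 * (∏ i ∈ Finset.range (n + 1), (2 * (s i : ℝ)) ^ 2) * |cfValue a - cfValue b| := by
  have has' : ∀ i, (a i : ℝ) + 1 ≤ 2 * s i := fun i => by exact_mod_cast has i
  have hbs' : ∀ i, (b i : ℝ) + 1 ≤ 2 * s i := fun i => by exact_mod_cast hbs i
  have h1 := prod_mul_abs_cfValue_shift_sub_le ha hb n h
  have h2 : (2 : ℝ) ≤ a n := by exact_mod_cast ha n
  have h2' : (2 : ℝ) ≤ b n := by exact_mod_cast hb n
  have hu := cfValue_nonneg fun k => ha (k + (n + 1))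
  have hv := cfValue_nonneg fun k => hb (k + (n + 1))
  have hu' := cfValue_le_half fun k => ha (k + (n + 1))
  have hv' := cfValue_le_half fun k => hb (k + (n + 1))
  rw [cfValue_shift_eq ha, cfValue_shift_eq hb,
    abs_inv_add_sub_inv_add (by linarith) (by linarith), div_le_iff₀ (by nlinarith)] at h1
  set u := cfValue fun k => a (k + (n + 1))
  set v := cfValue fun k => b (k + (n + 1))
  have hgap : 1 / 2 ≤ |(a n : ℝ) + u - (b n + v)| := by
    rcases lt_or_gt_of_ne hn with hlt | hlt
    · have : (a n : ℝ) + 1 ≤ b n := by exact_mod_cast hlt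
      rw [abs_sub_comm]
      exact le_trans (by linarith) (le_abs_self _)
    · have : (b n : ℝ) + 1 ≤ a n := by exact_mod_cast hlt
      exact le_trans (by linarith) (le_abs_self _)
  have hprod : (∏ i ∈ Finset.range n, ((a i : ℝ) + 1) ^ 2) ≤
      ∏ i ∈ Finset.range n, (2 * (s i : ℝ)) ^ 2 :=
    Finset.prod_le_prod (fun i _ => by positivity)
      fun i _ => pow_le_pow_left₀ (by positivity) (has' i) 2
  have hmul : ((a n : ℝ) + u) * (b n + v) ≤ (2 * (s n : ℝ)) ^ 2 := by
    have := has' n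
    have := hbs' n
    nlinarith
  have h3 : (∏ i ∈ Finset.range n, ((a i : ℝ) + 1) ^ 2) * |cfValue a - cfValue b| *
      (((a n : ℝ) + u) * (b n + v)) ≤ (∏ i ∈ Finset.range n, (2 * (s i : ℝ)) ^ 2) *
        |cfValue a - cfValue b| * (2 * (s n : ℝ)) ^ 2 := by
    gcongr
  rw [Finset.prod_range_succ]
  linarith

end cfValue

/-! ### Cantor series -/

/-- The remainders of the expansion of `y` as a Cantor series with bases `s`: each one is the
fractional part of the previous one multiplied by the base. -/
noncomputable def cantorRem (s : ℕ → ℕ) (y : ℝ) : ℕ → ℝ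
  | 0 => y
  | n + 1 => Int.fract (s n * cantorRem s y n)

/-- The digits of the expansion `y = ∑ d n / (s 0 * ⋯ * s n)` of `y ∈ [0, 1)` as a Cantor series
with bases `s`. -/
noncomputable def cantorDigit (s : ℕ → ℕ) (y : ℝ) (n : ℕ) : ℕ := ⌊s n * cantorRem s y n⌋₊

section cantor

variable {s : ℕ → ℕ} {y z : ℝ}

lemma cantorRem_mem_Ico (hy : y ∈ Ico (0 : ℝ) 1) (n : ℕ) : cantorRem s y n ∈ Ico (0 : ℝ) 1 := by
  cases n with
  | zero => exact hy
  | succ n => exact ⟨Int.fract_nonneg _, Int.fract_lt_one _⟩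

lemma cantorDigit_lt (hs : ∀ n, 2 ≤ s n) (hy : y ∈ Ico (0 : ℝ) 1) (n : ℕ) :
    cantorDigit s y n < s n := by
  have h := cantorRem_mem_Ico (s := s) hy n
  have h2 : (2 : ℝ) ≤ s n := by exact_mod_cast hs n
  rw [cantorDigit, Nat.floor_lt (mul_nonneg (by linarith) h.1)]
  nlinarith [h.2]

lemma cantorRem_succ_eq (hy : y ∈ Ico (0 : ℝ) 1) (n : ℕ) :
    cantorRem s y (n + 1) = s n * cantorRem s y n - cantorDigit s y n := by
  have h0 : 0 ≤ (s n : ℝ) * cantorRem s y n :=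
    mul_nonneg (Nat.cast_nonneg _) (cantorRem_mem_Ico hy n).1
  rw [cantorRem, cantorDigit, Int.fract, natCast_floor_eq_intCast_floor h0]

lemma cantorRem_sub_eq_prod_mul (hy : y ∈ Ico (0 : ℝ) 1) (hz : z ∈ Ico (0 : ℝ) 1) (n : ℕ)
    (h : ∀ i < n, cantorDigit s y i = cantorDigit s z i) :
    cantorRem s y n - cantorRem s z n = (∏ i ∈ Finset.range n, (s i : ℝ)) * (y - z) := by
  induction n with
  | zero => simp [cantorRem]
  | succ n ih =>
    rw [cantorRem_succ_eq hy, cantorRem_succ_eq hz, h n (by omega), Finset.prod_range_succ,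
      mul_right_comm, ← ih fun i hi => h i (by omega)]
    ring

lemma prod_mul_abs_sub_le_one (hy : y ∈ Ico (0 : ℝ) 1) (hz : z ∈ Ico (0 : ℝ) 1) (n : ℕ)
    (h : ∀ i < n, cantorDigit s y i = cantorDigit s z i) :
    (∏ i ∈ Finset.range n, (s i : ℝ)) * |y - z| ≤ 1 := by
  have h0 : (0 : ℝ) ≤ ∏ i ∈ Finset.range n, (s i : ℝ) :=
    Finset.prod_nonneg fun i _ => Nat.cast_nonneg _
  rw [← abs_of_nonneg h0, ← abs_mul, ← cantorRem_sub_eq_prod_mul hy hz n h]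
  have h1 := cantorRem_mem_Ico (s := s) hy n
  have h2 := cantorRem_mem_Ico (s := s) hz n
  rw [abs_le]
  constructor <;> linarith [h1.1, h1.2, h2.1, h2.2]

lemma exists_cantorDigit_ne (hs : ∀ n, 2 ≤ s n) (hy : y ∈ Ico (0 : ℝ) 1)
    (hz : z ∈ Ico (0 : ℝ) 1) (hne : y ≠ z) : ∃ n, cantorDigit s y n ≠ cantorDigit s z n := by
  by_contra! h
  have hpos : 0 < |y - z| := abs_pos.2 (sub_ne_zero.2 hne)
  obtain ⟨n, hn⟩ := pow_unbounded_of_one_lt (|y - z|⁻¹) (show (1 : ℝ) < 2 by norm_num)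
  have h1 := prod_mul_abs_sub_le_one (s := s) hy hz n fun i _ => h i
  have h2 : (2 : ℝ) ^ n ≤ ∏ i ∈ Finset.range n, (s i : ℝ) := by
    calc _ = ∏ _i ∈ Finset.range n, (2 : ℝ) := by simp
      _ ≤ _ := Finset.prod_le_prod (fun _ _ => by norm_num) fun i _ => by exact_mod_cast hs i
  have h3 : 1 < (2 : ℝ) ^ n * |y - z| := by
    rwa [inv_lt_iff_one_lt_mul₀ hpos] at hn
  nlinarith

end cantor

/-! ### The lower bound -/

/-- A map `g` whose inverse is Hölder continuous with exponent `r` decreases the dimension at most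
by the factor `r`. -/
lemma dimH_le_dimH_image_div {X Y : Type*} [EMetricSpace X] [EMetricSpace Y] {g : X → Y} {S : Set X}
    {C r : ℝ≥0} (hr : 0 < r)
    (h : ∀ y ∈ S, ∀ z ∈ S, edist y z ≤ C * edist (g y) (g z) ^ (r : ℝ)) :
    dimH S ≤ dimH (g '' S) / r := by
  have hinj : InjOn g S := fun y hy z hz hyz => by
    have := h y hy z hz
    rwa [hyz, edist_self, ENNReal.zero_rpow_of_pos (by exact_mod_cast hr), mul_zero,
      nonpos_iff_eq_zero, edist_eq_zero] at this
  rcases S.eq_empty_or_nonempty with rfl | hne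
  · simp
  have : Nonempty X := hne.to_type
  have hH : HolderOnWith C r (Function.invFunOn g S) (g '' S) := by
    rintro _ ⟨y, hy, rfl⟩ _ ⟨z, hz, rfl⟩
    rw [hinj.leftInvOn_invFunOn hy, hinj.leftInvOn_invFunOn hz]
    exact h y hy z hz
  have := hH.dimH_image_le hr
  rwa [hinj.leftInvOn_invFunOn.image_image] at this

/-- If `s` tends to infinity, but at most exponentially, then the products `s 0 * ⋯ * s (n - 1)`
grow faster than exponentially, so that an additional factor `s n` and exponential factors are
negligible. -/
lemma exists_prod_range_succ_le {s : ℕ → ℕ} (hs : ∀ n, 2 ≤ s n) (htop : Tendsto s atTop atTop)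
    {C B : ℝ} (hC : 0 < C) (hB : 0 < B) (hCB : ∀ n, (s n : ℝ) ≤ C * B ^ n) {p : ℝ} (hp : 1 < p) :
    ∃ D > 0, ∀ n, ∏ i ∈ Finset.range (n + 1), (2 * (s i : ℝ)) ≤
      D * (∏ i ∈ Finset.range n, (s i : ℝ)) ^ p := by
  have hε : 0 < p - 1 := by linarith
  obtain ⟨K, hK, hK1⟩ := (((tendsto_rpow_atTop hε).eventually_ge_atTop (2 * B)).and
    (eventually_ge_atTop 1)).exists
  obtain ⟨N, hN⟩ := eventually_atTop.1
    ((tendsto_natCast_atTop_atTop (R := ℝ)).comp htop |>.eventually_ge_atTop K)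
  have hs1 : ∀ n, (1 : ℝ) ≤ s n := fun n => by exact_mod_cast (by norm_num : 1 ≤ 2).trans (hs n)
  have hP1 : ∀ n, 1 ≤ ∏ i ∈ Finset.range n, (s i : ℝ) := fun n =>
    Finset.one_le_prod fun i _ => hs1 i
  have hKP : ∀ n, K ^ n ≤ K ^ N * ∏ i ∈ Finset.range n, (s i : ℝ) := by
    intro n
    induction n with
    | zero => simpa using one_le_pow₀ hK1
    | succ n ih =>
      rcases le_or_gt N n with h | h
      · rw [Finset.prod_range_succ, pow_succ, ← mul_assoc]
        have := hP1 n
        gcongr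
        exact hN n h
      · calc K ^ (n + 1) ≤ K ^ N := pow_le_pow_right₀ hK1 h
          _ ≤ _ := le_mul_of_one_le_right (by positivity) (hP1 _)
  refine ⟨2 * C * (K ^ N) ^ (p - 1), by positivity, fun n => ?_⟩
  have hP : 0 < ∏ i ∈ Finset.range n, (s i : ℝ) := by linarith [hP1 n]
  rw [Finset.prod_mul_distrib, Finset.prod_const, Finset.card_range, Finset.prod_range_succ]
  set P := ∏ i ∈ Finset.range n, (s i : ℝ)
  have hexp : (2 * B) ^ n ≤ (K ^ N * P) ^ (p - 1) :=
    calc (2 * B) ^ n ≤ (K ^ (p - 1)) ^ n := by gcongr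
      _ = (K ^ n) ^ (p - 1) := by
        rw [← Real.rpow_mul_natCast (by linarith), ← Real.rpow_natCast_mul (by linarith), mul_comm]
      _ ≤ _ := by gcongr; exact hKP n
  rw [Real.mul_rpow (by positivity) hP.le] at hexp
  calc 2 ^ (n + 1) * (P * s n) ≤ 2 ^ (n + 1) * (P * (C * B ^ n)) := by gcongr; exact hCB n
    _ = 2 * C * P * (2 * B) ^ n := by rw [mul_pow]; ring
    _ ≤ 2 * C * P * ((K ^ N) ^ (p - 1) * P ^ (p - 1)) := by gcongr
    _ = 2 * C * (K ^ N) ^ (p - 1) * (P ^ (p - 1) * P) := by ring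
    _ = _ := by rw [← Real.rpow_add_one hP.ne', sub_add_cancel]

/-- The number whose partial quotients are `s n` plus the digits of `y` as a Cantor series with
bases `s`, so that they lie between `s n` and `2 * s n - 1`. -/
noncomputable def cfOfCantor (s : ℕ → ℕ) (y : ℝ) : ℝ := cfValue fun n => s n + cantorDigit s y n

/-- The inverse of `cfOfCantor s` is Hölder continuous with any exponent `r < 1 / 2`: if the
digits of `y` and `z` first differ at the index `n`, then `|y - z|` is at most the inverse of
`P = s 0 * ⋯ * s (n - 1)`, while the distance of the continued fractions is at least `P ^ (-2)` up to
negligible factors. -/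
lemma exists_abs_sub_le_mul_abs_cfOfCantor_sub_rpow {s : ℕ → ℕ} (hs : ∀ n, 2 ≤ s n)
    (htop : Tendsto s atTop atTop) {C B : ℝ} (hC : 0 < C) (hB : 0 < B)
    (hCB : ∀ n, (s n : ℝ) ≤ C * B ^ n) {r : ℝ} (hr : 0 < r) (hr2 : r < 1 / 2) :
    ∃ A > 0, ∀ y ∈ Ico (0 : ℝ) 1, ∀ z ∈ Ico (0 : ℝ) 1,
      |y - z| ≤ A * |cfOfCantor s y - cfOfCantor s z| ^ r := by
  obtain ⟨D, hD, hDP⟩ := exists_prod_range_succ_le hs htop hC hB hCB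
    (p := 1 / (2 * r)) (by rw [lt_div_iff₀ (by linarith)]; linarith)
  refine ⟨(2 * D ^ 2) ^ r, by positivity, fun y hy z hz => ?_⟩
  rcases eq_or_ne y z with rfl | hne
  · simp [Real.zero_rpow hr.ne']
  have hex := exists_cantorDigit_ne hs hy hz hne
  classical
  set n := Nat.find hex
  have hn : cantorDigit s y n ≠ cantorDigit s z n := Nat.find_spec hex
  have hlt : ∀ i < n, cantorDigit s y i = cantorDigit s z i := fun i hi =>
    not_not.1 (Nat.find_min hex hi)
  have hquot : ∀ {w : ℝ}, w ∈ Ico (0 : ℝ) 1 → ∀ i, s i + cantorDigit s w i < 2 * s i :=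
    fun hw i => by have := cantorDigit_lt hs hw i; omega
  have h1 := prod_mul_abs_sub_le_one hy hz n hlt
  have h2 := one_le_prod_mul_abs_cfValue_sub (a := fun i => s i + cantorDigit s y i)
    (b := fun i => s i + cantorDigit s z i) (fun i => (hs i).trans (Nat.le_add_right _ _))
    (fun i => (hs i).trans (Nat.le_add_right _ _)) (hquot hy) (hquot hz)
    (fun i hi => by rw [hlt i hi]) (by simpa using hn)
  have hP : 0 < ∏ i ∈ Finset.range n, (s i : ℝ) :=
    Finset.prod_pos fun i _ => by exact_mod_cast two_pos.trans_le (hs i)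
  have h3 := hDP n
  have hQ : 0 ≤ ∏ i ∈ Finset.range (n + 1), (2 * (s i : ℝ)) :=
    Finset.prod_nonneg fun i _ => by positivity
  rw [Finset.prod_pow] at h2
  change 1 ≤ _ * |cfOfCantor s y - cfOfCantor s z| at h2
  set P := ∏ i ∈ Finset.range n, (s i : ℝ)
  set δ := |cfOfCantor s y - cfOfCantor s z|
  have hδ : 0 ≤ δ := abs_nonneg _
  have h4 : 1 ≤ 2 * D ^ 2 * (P ^ (1 / (2 * r))) ^ 2 * δ :=
    calc 1 ≤ _ := h2
      _ ≤ 2 * (D * P ^ (1 / (2 * r))) ^ 2 * δ := by gcongr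
      _ = _ := by ring
  have h5 : 1 ≤ (2 * D ^ 2) ^ r * P * δ ^ r := by
    have := Real.one_le_rpow h4 hr.le
    rw [Real.mul_rpow (by positivity) hδ, Real.mul_rpow (by positivity) (by positivity),
      ← Real.rpow_mul_natCast hP.le, ← Real.rpow_mul hP.le] at this
    have he : 1 / (2 * r) * (2 : ℕ) * r = 1 := by push_cast; field_simp
    rwa [he, Real.rpow_one] at this
  have h6 : P * |y - z| ≤ P * ((2 * D ^ 2) ^ r * δ ^ r) := by linarith
  exact le_of_mul_le_mul_left h6 hP

lemma half_le_dimH_image_cfOfCantor {s : ℕ → ℕ} (hs : ∀ n, 2 ≤ s n)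
    (htop : Tendsto s atTop atTop) {C B : ℝ} (hC : 0 < C) (hB : 0 < B)
    (hCB : ∀ n, (s n : ℝ) ≤ C * B ^ n) : 1 / 2 ≤ dimH (cfOfCantor s '' Ico (0 : ℝ) 1) := by
  have hhalf : (1 / 2 : ℝ≥0∞) = ((1 / 2 : ℝ≥0) : ℝ≥0∞) := by
    rw [ENNReal.coe_div (by norm_num)]; simp
  rw [hhalf]
  refine ENNReal.le_of_forall_nnreal_lt fun r hr => ?_
  rcases eq_zero_or_pos r with rfl | hr0
  · simp
  have hr2 : (r : ℝ) < 1 / 2 := by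
    have : r < 1 / 2 := by exact_mod_cast hr
    exact_mod_cast this
  obtain ⟨A, hA, h⟩ := exists_abs_sub_le_mul_abs_cfOfCantor_sub_rpow hs htop hC hB hCB
    (NNReal.coe_pos.2 hr0) hr2
  have hle := dimH_le_dimH_image_div (g := cfOfCantor s) (S := Ico (0 : ℝ) 1) (C := A.toNNReal) hr0
    fun y hy z hz => by
      rw [edist_dist, edist_dist, Real.dist_eq, Real.dist_eq,
        ENNReal.ofReal_rpow_of_nonneg (abs_nonneg _) r.coe_nonneg]
      change _ ≤ ENNReal.ofReal A * _
      rw [← ENNReal.ofReal_mul hA.le]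
      exact ENNReal.ofReal_le_ofReal (h y hy z hz)
  rw [dimH_Ico_zero_one, ENNReal.le_div_iff_mul_le (.inl (by simpa using hr0.ne')) (.inl (by simp)),
    one_mul] at hle
  exact hle

lemma tau_cfOfCantor {s : ℕ → ℕ} (hs : ∀ n, 2 ≤ s n) {α : ℝ≥0}
    (hα : ∀ t > α, Summable fun n => (s n : ℝ) ^ (-(t : ℝ)))
    (hα' : ∀ t : ℝ≥0, (Summable fun n => (s n : ℝ) ^ (-(t : ℝ))) → α ≤ t) {y : ℝ}
    (hy : y ∈ Ico (0 : ℝ) 1) : tau (cfOfCantor s y) = α := by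
  have hs0 : ∀ n, (0 : ℝ) < s n := fun n => by exact_mod_cast two_pos.trans_le (hs n)
  have hle : ∀ n, (s n : ℝ) ≤ (s n + cantorDigit s y n : ℕ) := fun n => by simp
  have hge : ∀ n, ((s n + cantorDigit s y n : ℕ) : ℝ) ≤ 2 * s n := fun n => by
    have := cantorDigit_lt hs hy n
    exact_mod_cast (by omega : s n + cantorDigit s y n ≤ 2 * s n)
  rw [cfOfCantor, tau_cfValue fun n => (hs n).trans (Nat.le_add_right _ _)]
  apply le_antisymm
  · refine ENNReal.le_of_forall_pos_le_add fun ε hε _ => ?_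
    refine iInf₂_le_of_le (α + ε) ?_ (by push_cast; exact le_rfl)
    refine (hα (α + ε) (lt_add_of_pos_right α hε)).of_nonneg_of_le (fun n => by positivity)
      fun n => ?_
    exact Real.rpow_le_rpow_of_nonpos (hs0 n) (hle n) (neg_nonpos.2 (NNReal.coe_nonneg _))
  · refine le_iInf₂ fun t ht => ?_
    refine ENNReal.coe_le_coe.2 (hα' t ?_)
    refine (ht.mul_left ((2 : ℝ) ^ (t : ℝ))).of_nonneg_of_le (fun n => by positivity) fun n => ?_
    calc (s n : ℝ) ^ (-(t : ℝ)) = 2 ^ (t : ℝ) * (2 * (s n : ℝ)) ^ (-(t : ℝ)) := by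
          rw [Real.mul_rpow (by norm_num) (hs0 n).le, ← mul_assoc, ← Real.rpow_add (by norm_num)]
          simp
      _ ≤ _ := by
          gcongr 2 ^ (t : ℝ) * ?_
          exact Real.rpow_le_rpow_of_nonpos ((hs0 n).trans_le (hle n)) (hge n) (by simp)

/-- Sequences with a given convergence exponent `α` that tend to infinity, but at most
exponentially: `2 ^ (n + 1)` for `α = 0`, and approximately `n ^ (1 / α)` for `α > 0`. -/
lemma exists_seq_convergence_exponent (α : ℝ≥0) :
    ∃ s : ℕ → ℕ, (∀ n, 2 ≤ s n) ∧ Tendsto s atTop atTop ∧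
      (∃ C > (0 : ℝ), ∃ B > (0 : ℝ), ∀ n, (s n : ℝ) ≤ C * B ^ n) ∧
      (∀ t > α, Summable fun n => (s n : ℝ) ^ (-(t : ℝ))) ∧
      ∀ t : ℝ≥0, (Summable fun n => (s n : ℝ) ^ (-(t : ℝ))) → α ≤ t := by
  rcases eq_zero_or_pos α with rfl | hα
  · refine ⟨fun n => 2 ^ (n + 1), fun n => ?_, ?_, ⟨2, by norm_num, 2, by norm_num, fun n => ?_⟩,
      fun t ht => ?_, fun t _ => bot_le⟩
    · exact Nat.le_self_pow (by omega) 2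
    · exact (tendsto_pow_atTop_atTop_of_one_lt (by norm_num)).comp (tendsto_add_atTop_nat 1)
    · push_cast; rw [pow_succ']
    · have ht' : (0 : ℝ) < t := ht
      have h1 : (2 : ℝ) ^ (-(t : ℝ)) < 1 :=
        Real.rpow_lt_one_of_one_lt_of_neg (by norm_num) (by simpa)
      have := (summable_nat_add_iff 1).2
        (summable_geometric_of_lt_one (by positivity) h1)
      refine this.congr fun n => ?_
      push_cast
      rw [← Real.rpow_mul_natCast (by norm_num), ← Real.rpow_natCast_mul (by norm_num), mul_comm]
  · have hα0 : (0 : ℝ) < α := hα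
    have hα1 : (0 : ℝ) < (α : ℝ)⁻¹ := by positivity
    have hpow : ∀ n : ℕ, (1 : ℝ) ≤ ((n : ℝ) + 1) ^ (α : ℝ)⁻¹ := fun n =>
      Real.one_le_rpow (by simp) hα1.le
    have hlow : ∀ n : ℕ, ((n : ℝ) + 1) ^ (α : ℝ)⁻¹ ≤
        ((⌈((n : ℝ) + 1) ^ (α : ℝ)⁻¹⌉₊ + 1 : ℕ) : ℝ) := fun n => by
      push_cast
      linarith [Nat.le_ceil (((n : ℝ) + 1) ^ (α : ℝ)⁻¹)]
    have hupp : ∀ n : ℕ, ((⌈((n : ℝ) + 1) ^ (α : ℝ)⁻¹⌉₊ + 1 : ℕ) : ℝ) ≤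
        3 * ((n : ℝ) + 1) ^ (α : ℝ)⁻¹ := fun n => by
      push_cast
      linarith [Nat.ceil_lt_add_one (zero_le_one.trans (hpow n)), hpow n]
    -- The comparison series is `∑ (n + 1) ^ (-t / α)`, which converges if and only if `t > α`.
    have hsum : ∀ t : ℝ, (Summable fun n : ℕ => (((n : ℝ) + 1) ^ (α : ℝ)⁻¹) ^ (-t)) ↔
        (α : ℝ) < t := fun t => by
      have h1 : ∀ n : ℕ, (((n : ℝ) + 1) ^ (α : ℝ)⁻¹) ^ (-t) =
          ((n + 1 : ℕ) : ℝ) ^ ((α : ℝ)⁻¹ * -t) := fun n => by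
        rw [← Real.rpow_mul (by positivity)]; push_cast; rfl
      simp only [h1]
      rw [summable_nat_add_iff 1 (f := fun n : ℕ => (n : ℝ) ^ ((α : ℝ)⁻¹ * -t)),
        Real.summable_nat_rpow, mul_neg, neg_lt_neg_iff, lt_inv_mul_iff₀ hα0, mul_one]
    refine ⟨fun n => ⌈((n : ℝ) + 1) ^ (α : ℝ)⁻¹⌉₊ + 1, fun n => ?_, ?_,
      ⟨3, by norm_num, 2 ^ (α : ℝ)⁻¹, by positivity, fun n => ?_⟩, fun t ht => ?_, fun t ht => ?_⟩
    · have : 0 < ⌈((n : ℝ) + 1) ^ (α : ℝ)⁻¹⌉₊ := Nat.ceil_pos.2 (by linarith [hpow n])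
      exact Nat.succ_le_succ this
    · refine (tendsto_natCast_atTop_iff (R := ℝ)).1 (tendsto_atTop_mono hlow ?_)
      exact (tendsto_rpow_atTop hα1).comp
        (tendsto_atTop_add_const_right _ _ tendsto_natCast_atTop_atTop)
    · refine (hupp n).trans ?_
      rw [← Real.rpow_mul_natCast (by norm_num), mul_comm _ (n : ℝ),
        Real.rpow_natCast_mul (by norm_num)]
      gcongr
      exact_mod_cast Nat.lt_two_pow_self (n := n)
    · refine ((hsum t).2 ht).of_nonneg_of_le (fun n => by positivity) fun n => ?_
      exact Real.rpow_le_rpow_of_nonpos (by linarith [hpow n]) (hlow n) (by simp)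
    · refine NNReal.coe_le_coe.1 ((hsum t).1 ?_).le
      refine (ht.mul_left ((3 : ℝ) ^ (t : ℝ))).of_nonneg_of_le (fun n => by positivity)
        fun n => ?_
      have h0 := hpow n
      calc (((n : ℝ) + 1) ^ (α : ℝ)⁻¹) ^ (-(t : ℝ))
          = 3 ^ (t : ℝ) * (3 * ((n : ℝ) + 1) ^ (α : ℝ)⁻¹) ^ (-(t : ℝ)) := by
            rw [Real.mul_rpow (by norm_num) (by linarith), ← mul_assoc,
              ← Real.rpow_add (by norm_num)]
            simp
        _ ≤ _ := by
            gcongr 3 ^ (t : ℝ) * ?_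
            exact Real.rpow_le_rpow_of_nonpos (by positivity) (hupp n) (by simp)

lemma half_le_dimH_tau_eq (α : ℝ≥0) :
    1 / 2 ≤ dimH {x : ℝ | x ∈ Ico (0 : ℝ) 1 ∧ tau x = (α : ℝ≥0∞)} := by
  obtain ⟨s, hs, htop, ⟨C, hC, B, hB, hCB⟩, hα, hα'⟩ := exists_seq_convergence_exponent α
  refine (half_le_dimH_image_cfOfCantor hs htop hC hB hCB).trans (dimH_mono ?_)
  rintro _ ⟨y, hy, rfl⟩
  have ha : ∀ n, 2 ≤ s n + cantorDigit s y n := fun n => (hs n).trans (Nat.le_add_right _ _)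
  exact ⟨⟨cfValue_nonneg ha, (cfValue_le_half ha).trans_lt (by norm_num)⟩,
    tau_cfOfCantor hs hα hα' hy⟩

theorem mainTheorem2 :
    (∀ α : ℝ≥0, dimH {x : ℝ | x ∈ Set.Ico (0 : ℝ) 1 ∧ tau x = (α : ℝ≥0∞)} = 1 / 2) ∧
      dimH {x : ℝ | x ∈ Set.Ico (0 : ℝ) 1 ∧ tau x = ∞} = 1 := by
  refine ⟨fun α => le_antisymm ?_ (half_le_dimH_tau_eq α), dimH_tau_eq_top⟩
  refine (dimH_mono ?_).trans dimH_tau_lt_top_le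
  rintro x ⟨hx, hτ⟩
  exact ⟨hx, hτ ▸ ENNReal.coe_lt_top⟩
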